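/- For $a,b,c>0$ let $F(a,b;c;x)=\sum_{n\ge 0}\frac{(a)_n(b)_n}{(c)_n}\frac{x^n}{n!}$, $|x|<1$, be the Gaussian hypergeometric function, where $(t)_0=1$ and $(t)_n=t(t+1)\cdots(t+n-1)$ for $n\ge 1$. Put $v(x)=F(a,b;c;x)$ and $v_1(x)=v(1-x)$, and define the Legendre $\mathcal M$-function on $(0,1)$ by $$\mathcal M(x)=\mathcal M(a,b,c,x)=x(1-x)\left(v_1(x)\frac{dv}{dx}(x)-v(x)\frac{dv_1}{dx}(x)\right).$$ Theorem. For all real numbers $a,b,c>0$ the following hold. (i) $\mathcal M$ is continuous on $(0,1)$, and $\mathcal M(x)=\mathcal M(1-x)>0$ for all $x\in(0,1)$. (ii) If $(a+b-1)(c-b)>0$, $a+b\ge c\ge a$ and $ab/(a+b+1)<c$, then $\mathcal M$ is strictly convex on $(0,1)$, strictly decreasing on $(0,1/2]$ and strictly increasing on $[1/2,1)$. (iii) If $(a+b-1)(c-b)<0$, $a+b\le c$ and $ab/(a+b+1)<c$, then $\mathcal M$ is strictly concave on $(0,1)$, strictly increasing on $(0,1/2]$ and strictly decreasing on $[1/2,1)$.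 (iv) If $a+b\ge c$, then $\mathcal M(r)>ab/c$ for all $r\in(0,1)$. -/

import Mathlib

/-- The Legendre M-function on the real line,
`M(a,b,c,x) = x (1 - x) (v₁(x) v'(x) - v(x) v₁'(x))`, where `v(x) = F(a,b;c;x)` is the Gaussian
hypergeometric function and `v₁(x) = v(1 - x)`. It is meaningful for `x ∈ (0,1)`, where both
`x` and `1 - x` lie in the disk of convergence of the hypergeometric series. -/
noncomputable def legendreM (a b c x : ℝ) : ℝ :=
  x * (1 - x) *
    (₂F₁ a b c (1 - x) * deriv (fun t : ℝ => (₂F₁ a b c t : ℝ)) x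
      - ₂F₁ a b c x * deriv (fun t : ℝ => (₂F₁ a b c (1 - t) : ℝ)) x)

/-! Write `v` for F(a,b;c;x), `h` for (b/c) F(a,b+1;c+1;x), and a subscript 1 for reflection x ↦
1-x. The contiguous relations for `v'` and `h'` give M = (c-a) L + (a+b-c) v v₁ with L = v v₁ - x h
v₁ - (1-x) h₁ v (`legendreM_eq_legendreL`). They also give L' = (a+b-1)(h v₁ - h₁ v), while v v₁ has
derivative v'(x) v(1-x) - v'(1-x) v(x).

Both derivatives contain f(x) v(1-x) - f(1-x) v(x) = v v₁ (f/v (x) - f/v (1-x)), with f = h or f =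
v'. The quotient f/v is monotone because the ratio of Taylor coefficients is
(`powerSum_mul_lt_mul`), and v v₁ increases on [1/2,1); so the expression is monotone
(`strictMonoOn_cross`). The sign conditions in (ii) and (iii) make the two summands of M bend the
same way. Symmetry about 1/2 then gives the monotonicity of M.

For (iv), the coefficients of (1-x) v' are positive when c ≤ a+b, and the constant one is ab/c. -/

open Filter Topology Set

/-! ### Power series on (0,1) and monotone coefficient ratios -/

/-- The sum of the real power series with coefficients `f`. -/
noncomputable def powerSum (f : ℕ → ℝ) (x : ℝ) : ℝ := ∑' n, f n * x ^ n

/-- The power series with coefficients `f` converges at every point of `(0,1)`. -/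
def SummableOnUnit (f : ℕ → ℝ) : Prop := ∀ x ∈ Ioo (0 : ℝ) 1, Summable fun n => f n * x ^ n

lemma SummableOnUnit.sub {f g : ℕ → ℝ} (hf : SummableOnUnit f) (hg : SummableOnUnit g) :
    SummableOnUnit (fun n => f n - g n) := fun x hx => by
  simpa only [sub_mul] using (hf x hx).sub (hg x hx)

lemma SummableOnUnit.const_mul {f : ℕ → ℝ} (hf : SummableOnUnit f) (k : ℝ) :
    SummableOnUnit (fun n => k * f n) := fun x hx => by
  simpa only [mul_assoc] using (hf x hx).mul_left k

lemma powerSum_sub {f g : ℕ → ℝ} (hf : SummableOnUnit f) (hg : SummableOnUnit g) {x : ℝ}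
    (hx : x ∈ Ioo (0 : ℝ) 1) :
    powerSum (fun n => f n - g n) x = powerSum f x - powerSum g x := by
  simp only [powerSum, sub_mul]
  exact (hf x hx).tsum_sub (hg x hx)

lemma powerSum_const_mul (f : ℕ → ℝ) (k x : ℝ) :
    powerSum (fun n => k * f n) x = k * powerSum f x := by
  simp only [powerSum, mul_assoc]
  exact tsum_mul_left

lemma powerSum_pos {f : ℕ → ℝ} (hf : SummableOnUnit f) (hpos : ∀ n, 0 < f n) {x : ℝ}
    (hx : x ∈ Ioo (0 : ℝ) 1) : 0 < powerSum f x :=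
  (hf x hx).tsum_pos (fun n => (mul_pos (hpos n) (pow_pos hx.1 n)).le) 0
    (mul_pos (hpos 0) (pow_pos hx.1 0))

lemma coeff_zero_lt_powerSum {f : ℕ → ℝ} (hf : SummableOnUnit f) (hpos : ∀ n, 0 < f n) {x : ℝ}
    (hx : x ∈ Ioo (0 : ℝ) 1) : f 0 < powerSum f x := by
  have h := (hf x hx).sum_le_tsum (Finset.range 2)
    (fun n _ => (mul_pos (hpos n) (pow_pos hx.1 n)).le)
  have h1 := mul_pos (hpos 1) hx.1
  simp only [Finset.sum_range_succ, Finset.sum_range_zero, pow_zero, pow_one] at h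
  simp only [powerSum]
  linarith

lemma summableOnUnit_of_ratio {f t : ℕ → ℝ} (hpos : ∀ n, 0 < f n)
    (hstep : ∀ n, f (n + 1) = f n * t n) (ht : Tendsto t atTop (𝓝 1)) : SummableOnUnit f := by
  intro x hx
  refine summable_of_ratio_test_tendsto_lt_one hx.2
    (Eventually.of_forall fun n => (mul_pos (hpos n) (pow_pos hx.1 n)).ne') ?_
  have h : Tendsto (fun n => t n * x) atTop (𝓝 x) := by simpa using ht.mul_const x
  refine h.congr fun n => ?_
  have h1 := hpos n
  have h2 := pow_pos hx.1 n
  rw [Real.norm_of_nonneg (mul_pos (hpos _) (pow_pos hx.1 _)).le,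
    Real.norm_of_nonneg (mul_pos h1 h2).le, hstep, pow_succ]
  field_simp

lemma hasDerivAt_powerSum {f : ℕ → ℝ} (hf : SummableOnUnit f) (hpos : ∀ n, 0 ≤ f n)
    (hd : SummableOnUnit fun n => n * f n) {x : ℝ} (hx : x ∈ Ioo (0 : ℝ) 1) :
    HasDerivAt (powerSum f) (powerSum (fun n => n * f n) x / x) x := by
  obtain ⟨r, hxr, hr⟩ := exists_between hx.2
  have hr0 : 0 < r := hx.1.trans hxr
  have key : ∀ (n : ℕ) (y : ℝ), 0 < y → f n * (n * y ^ (n - 1)) = n * f n * y ^ n * y⁻¹ := by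
    intro n y hy
    rcases n with _ | n
    · simp
    · rw [Nat.add_sub_cancel, pow_succ]; field_simp
  -- Nonnegative coefficients let the derivative series on (0,r) be dominated by its value at r.
  have h := hasDerivAt_tsum_of_isPreconnected (g := fun n y => f n * y ^ n)
    (g' := fun n y => f n * (n * y ^ (n - 1))) (u := fun n => n * f n * r ^ n * r⁻¹)
    (t := Ioo 0 r) (y₀ := x) (y := x) ((hd r ⟨hr0, hr⟩).mul_right _) isOpen_Ioo
    isPreconnected_Ioo (fun n y _ => (hasDerivAt_pow n y).const_mul (f n)) ?_ ⟨hx.1, hxr⟩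
    (hf x hx) ⟨hx.1, hxr⟩
  · simp only [key _ x hx.1, tsum_mul_right] at h
    exact h
  · intro n y hy
    have hy0 := hy.1
    rw [← key n r hr0, Real.norm_of_nonneg (mul_nonneg (hpos n) (by positivity))]
    exact mul_le_mul_of_nonneg_left
      (mul_le_mul_of_nonneg_left (pow_le_pow_left₀ hy0.le hy.2.le _) (Nat.cast_nonneg n)) (hpos n)

/-- Expanding the difference as a double series and adding its image under (m,n) ↦ (n,m) gives terms
whose sign can be read off; hence the factor 2. -/
lemma powerSum_mul_sub_hasSum {f s : ℕ → ℝ} (hf : SummableOnUnit f)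
    (hfs : SummableOnUnit fun n => s n * f n) {x y : ℝ}
    (hx : x ∈ Ioo (0 : ℝ) 1) (hy : y ∈ Ioo (0 : ℝ) 1) :
    HasSum (fun p : ℕ × ℕ =>
        (s p.2 - s p.1) * (f p.1 * f p.2) * (y ^ p.2 * x ^ p.1 - y ^ p.1 * x ^ p.2))
      (2 * (powerSum (fun n => s n * f n) y * powerSum f x
        - powerSum (fun n => s n * f n) x * powerSum f y)) := by
  have P : ∀ z ∈ Ioo (0 : ℝ) 1, ∀ w ∈ Ioo (0 : ℝ) 1,
      HasSum (fun p : ℕ × ℕ => s p.1 * f p.1 * z ^ p.1 * (f p.2 * w ^ p.2))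
        (powerSum (fun n => s n * f n) z * powerSum f w) := by
    intro z hz w hw
    have h1 : Summable fun n => s n * f n * z ^ n := hfs z hz
    have h2 : Summable fun n => f n * w ^ n := hf w hw
    have h3 := summable_mul_of_summable_norm h1.norm h2.norm
    exact h1.hasSum.mul h2.hasSum h3
  have h1 := (P y hy x hx).sub (P x hx y hy)
  have h2 := h1.add ((Equiv.prodComm ℕ ℕ).hasSum_iff.mpr h1)
  rw [← two_mul] at h2
  refine h2.congr_fun fun p => ?_
  simp only [Function.comp_apply, Equiv.prodComm_apply, Prod.fst_swap, Prod.snd_swap]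
  ring

/-- If the ratio of the coefficients of two power series increases strictly, then so does the
ratio of their sums (in cross-multiplied form). -/
lemma powerSum_mul_lt_mul {f s : ℕ → ℝ} (hf : SummableOnUnit f) (hpos : ∀ n, 0 < f n)
    (hs : StrictMono s) (hfs : SummableOnUnit fun n => s n * f n) {x y : ℝ}
    (hx : 0 < x) (hxy : x < y) (hy : y < 1) :
    powerSum (fun n => s n * f n) x * powerSum f y
      < powerSum (fun n => s n * f n) y * powerSum f x := by
  have hy0 := hx.trans hxy
  have hterm : ∀ m n : ℕ, m < n →
      0 < (s n - s m) * (f m * f n) * (y ^ n * x ^ m - y ^ m * x ^ n) := by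
    intro m n hmn
    refine mul_pos (mul_pos (sub_pos.2 (hs hmn)) (mul_pos (hpos _) (hpos _))) ?_
    obtain ⟨k, rfl⟩ := Nat.exists_eq_add_of_lt hmn
    have e : y ^ (m + k + 1) * x ^ m - y ^ m * x ^ (m + k + 1)
        = y ^ m * x ^ m * (y ^ (k + 1) - x ^ (k + 1)) := by ring
    rw [e]
    exact mul_pos (mul_pos (pow_pos hy0 m) (pow_pos hx m))
      (sub_pos.2 (pow_lt_pow_left₀ hxy hx.le k.succ_ne_zero))
  have h2 := powerSum_mul_sub_hasSum hf hfs ⟨hx, hxy.trans hy⟩ ⟨hy0, hy⟩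
  have h4 := h2.summable.tsum_pos (fun p => ?_) (0, 1) (hterm 0 1 zero_lt_one)
  · rw [h2.tsum_eq] at h4
    linarith
  · rcases lt_trichotomy p.1 p.2 with h | h | h
    · exact (hterm _ _ h).le
    · simp [h]
    · refine (hterm _ _ h).le.trans_eq ?_
      ring

/-! ### Reflection about 1/2 and convexity -/

lemma one_sub_mem_unit {x : ℝ} (hx : x ∈ Ioo (0 : ℝ) 1) : 1 - x ∈ Ioo (0 : ℝ) 1 :=
  ⟨by linarith [hx.2], by linarith [hx.1]⟩

/-- An odd (about `1/2`) function that increases on `[1/2,1)` increases on `(0,1)`. -/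
lemma strictMonoOn_unit_of_odd {q : ℝ → ℝ} (hodd : ∀ x ∈ Ioo (0 : ℝ) 1, q (1 - x) = -q x)
    (hq : StrictMonoOn q (Ico (1 / 2) 1)) : StrictMonoOn q (Ioo 0 1) := by
  have hl : StrictMonoOn q (Ioc 0 (1 / 2)) := by
    intro x hx y hy hxy
    have h := hq (a := 1 - y) (b := 1 - x) ⟨by linarith [hy.2], by linarith [hy.1]⟩
      ⟨by linarith [hx.2], by linarith [hx.1]⟩ (by linarith)
    rw [hodd x ⟨hx.1, by linarith [hx.2]⟩, hodd y ⟨hy.1, by linarith [hy.2]⟩] at h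
    linarith
  intro x hx y hy hxy
  rcases le_total y (1 / 2) with h | h
  · exact hl ⟨hx.1, by linarith⟩ ⟨hy.1, h⟩ hxy
  rcases le_total x (1 / 2) with h' | h'
  · have h1 := hl.monotoneOn ⟨hx.1, h'⟩ ⟨by norm_num, le_rfl⟩ h'
    have h2 := hq.monotoneOn ⟨le_rfl, by norm_num⟩ ⟨h, hy.2⟩ h
    rcases h.lt_or_eq with h3 | h3
    · exact h1.trans_lt (hq ⟨le_rfl, by norm_num⟩ ⟨h, hy.2⟩ h3)
    · subst h3
      exact hl ⟨hx.1, h'⟩ ⟨by norm_num, le_rfl⟩ hxy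
  · exact hq ⟨h', hx.2⟩ ⟨h, hy.2⟩ hxy

/-- If `f / v` increases and `x ↦ v x * v (1 - x)` increases on `[1/2,1)`, then
`f x * v (1 - x) - f (1 - x) * v x` increases. -/
lemma strictMonoOn_cross {f v : ℝ → ℝ} (hv : ∀ x ∈ Ioo (0 : ℝ) 1, 0 < v x)
    (hmono : MonotoneOn (fun x => v x * v (1 - x)) (Ico (1 / 2) 1))
    (hfv : ∀ x y, 0 < x → x < y → y < 1 → f x * v y < f y * v x) :
    StrictMonoOn (fun x => f x * v (1 - x) - f (1 - x) * v x) (Ioo 0 1) := by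
  have hρ : ∀ x y, 0 < x → x < y → y < 1 → f x / v x < f y / v y := fun x y hx hxy hy => by
    rw [div_lt_div_iff₀ (hv x ⟨hx, hxy.trans hy⟩) (hv y ⟨hx.trans hxy, hy⟩)]
    exact hfv x y hx hxy hy
  have hq : ∀ x ∈ Ioo (0 : ℝ) 1, f x * v (1 - x) - f (1 - x) * v x
      = v x * v (1 - x) * (f x / v x - f (1 - x) / v (1 - x)) := fun x hx => by
    have h1 := (hv x hx).ne'
    have h2 := (hv _ (one_sub_mem_unit hx)).ne'
    field_simp
  refine strictMonoOn_unit_of_odd (fun x _ => by simp only [sub_sub_cancel]; ring) ?_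
  intro x hx y hy hxy
  have hx' : x ∈ Ioo (0 : ℝ) 1 := ⟨by linarith [hx.1], hx.2⟩
  have hy' : y ∈ Ioo (0 : ℝ) 1 := ⟨by linarith [hy.1], hy.2⟩
  simp only
  rw [hq x hx', hq y hy']
  have h1 := hρ x y hx'.1 hxy hy.2
  have h2 := hρ (1 - y) (1 - x) (by linarith [hy.2]) (by linarith) (by linarith [hx'.1])
  have h3 : f (1 - x) / v (1 - x) ≤ f x / v x := by
    rcases hx.1.lt_or_eq with h | h
    · exact (hρ (1 - x) x (by linarith [hx.2]) (by linarith) hx.2).le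
    · rw [show 1 - x = x by linarith]
  have h4 := hmono hx hy hxy.le
  have h5 := mul_pos (hv y hy') (hv _ (one_sub_mem_unit hy'))
  calc _ ≤ v y * v (1 - y) * (f x / v x - f (1 - x) / v (1 - x)) :=
        mul_le_mul_of_nonneg_right h4 (by linarith)
    _ < _ := mul_lt_mul_of_pos_left (by linarith) h5

lemma strictConvexOn_unit_of_hasDerivAt {f g : ℝ → ℝ}
    (hf : ∀ x ∈ Ioo (0 : ℝ) 1, HasDerivAt f (g x) x) (hg : StrictMonoOn g (Ioo 0 1)) :
    StrictConvexOn ℝ (Ioo 0 1) f := by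
  refine StrictMonoOn.strictConvexOn_of_deriv (convex_Ioo 0 1)
    (fun x hx => (hf x hx).continuousAt.continuousWithinAt) ?_
  rw [interior_Ioo]
  exact hg.congr fun x hx => (hf x hx).deriv.symm

/-- The point y lies strictly between x and 1-x, where f takes equal values. -/
lemma strictConvexOn_symm_strictAntiOn {f : ℝ → ℝ} (hf : StrictConvexOn ℝ (Ioo 0 1) f)
    (hs : ∀ x ∈ Ioo (0 : ℝ) 1, f x = f (1 - x)) : StrictAntiOn f (Ioc 0 (1 / 2)) := by
  intro x hx y hy hxy
  have hx' : x ∈ Ioo (0 : ℝ) 1 := ⟨hx.1, by linarith [hx.2]⟩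
  have h := hf.lt_on_openSegment hx' (one_sub_mem_unit hx') (by linarith [hy.2]) (z := y)
    (by rw [openSegment_eq_Ioo (by linarith [hy.2])]; exact ⟨hxy, by linarith [hy.2]⟩)
  rwa [← hs x hx', max_self] at h

lemma strictConvexOn_symm_strictMonoOn {f : ℝ → ℝ} (hf : StrictConvexOn ℝ (Ioo 0 1) f)
    (hs : ∀ x ∈ Ioo (0 : ℝ) 1, f x = f (1 - x)) : StrictMonoOn f (Ico (1 / 2) 1) := by
  intro x hx y hy hxy
  rw [hs x ⟨by linarith [hx.1], hx.2⟩, hs y ⟨by linarith [hy.1], hy.2⟩]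
  exact strictConvexOn_symm_strictAntiOn hf hs ⟨by linarith [hy.2], by linarith [hy.1]⟩
    ⟨by linarith [hx.2], by linarith [hx.1]⟩ (by linarith)

/-! ### Hypergeometric coefficients and contiguous relations -/

namespace Hypergeometric

/-- Taylor coefficients of `₂F₁ a b c`. -/
noncomputable def coeff (a b c : ℝ) (n : ℕ) : ℝ := ordinaryHypergeometricCoefficient a b c n

/-- Taylor coefficients of the derivative of `₂F₁ a b c`. -/
noncomputable def derivCoeff (a b c : ℝ) (n : ℕ) : ℝ := (a + n) * (b + n) / (c + n) * coeff a b c n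

/-- Taylor coefficients of `(b / c) * ₂F₁ a (b + 1) (c + 1)`. -/
noncomputable def shiftCoeff (a b c : ℝ) (n : ℕ) : ℝ := (b + n) / (c + n) * coeff a b c n

variable {a b c : ℝ}

lemma powerSum_coeff (a b c : ℝ) : powerSum (coeff a b c) = (₂F₁ a b c : ℝ → ℝ) := by
  rw [ordinaryHypergeometric_eq_tsum]
  rfl

lemma coeff_zero (a b c : ℝ) : coeff a b c 0 = 1 := by
  simp [coeff, ordinaryHypergeometricCoefficient]

lemma coeff_pos (ha : 0 < a) (hb : 0 < b) (hc : 0 < c) (n : ℕ) : 0 < coeff a b c n := by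
  have h1 := ascPochhammer_pos n a ha
  have h2 := ascPochhammer_pos n b hb
  have h3 := ascPochhammer_pos n c hc
  simp only [coeff, ordinaryHypergeometricCoefficient]
  positivity

lemma coeff_succ (hc : 0 < c) (n : ℕ) :
    coeff a b c (n + 1) = coeff a b c n * ((a + n) * (b + n) / ((c + n) * (n + 1))) := by
  have h3 := (ascPochhammer_pos n c hc).ne'
  have h4 : c + n ≠ 0 := by positivity
  simp only [coeff, ordinaryHypergeometricCoefficient, ascPochhammer_succ_eval,
    Nat.factorial_succ, Nat.cast_mul, Nat.cast_succ]
  field_simp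

lemma tendsto_add_div_add (p q : ℝ) :
    Tendsto (fun n : ℕ => (p + n) / (q + n)) atTop (𝓝 1) := by
  simpa using tendsto_add_mul_div_add_mul_atTop_nhds p q 1 (one_ne_zero (α := ℝ))

lemma summableOnUnit_coeff (ha : 0 < a) (hb : 0 < b) (hc : 0 < c) :
    SummableOnUnit (coeff a b c) := by
  refine summableOnUnit_of_ratio (coeff_pos ha hb hc) (coeff_succ hc) ?_
  have h := (tendsto_add_div_add a c).mul (tendsto_add_div_add b 1)
  rw [one_mul] at h
  refine h.congr fun n => ?_
  rw [div_mul_div_comm, add_comm (1 : ℝ)]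

lemma shiftCoeff_pos (ha : 0 < a) (hb : 0 < b) (hc : 0 < c) (n : ℕ) : 0 < shiftCoeff a b c n :=
  mul_pos (by positivity) (coeff_pos ha hb hc n)

lemma derivCoeff_pos (ha : 0 < a) (hb : 0 < b) (hc : 0 < c) (n : ℕ) : 0 < derivCoeff a b c n :=
  mul_pos (by positivity) (coeff_pos ha hb hc n)

lemma summableOnUnit_shiftCoeff (ha : 0 < a) (hb : 0 < b) (hc : 0 < c) :
    SummableOnUnit (shiftCoeff a b c) := by
  refine summableOnUnit_of_ratio (shiftCoeff_pos ha hb hc)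
    (t := fun n => (a + n) / (1 + n) * ((b + 1 + n) / (c + 1 + n))) (fun n => ?_) ?_
  · simp only [shiftCoeff, coeff_succ hc]
    have h1 : c + n ≠ 0 := by positivity
    have h2 : c + 1 + n ≠ 0 := by positivity
    have h3 : c + (n + 1) ≠ 0 := by positivity
    have h4 : (1 : ℝ) + n ≠ 0 := by positivity
    push_cast
    field_simp
    ring
  · simpa using (tendsto_add_div_add a 1).mul (tendsto_add_div_add (b + 1) (c + 1))

lemma summableOnUnit_derivCoeff (ha : 0 < a) (hb : 0 < b) (hc : 0 < c) :
    SummableOnUnit (derivCoeff a b c) := by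
  refine summableOnUnit_of_ratio (derivCoeff_pos ha hb hc)
    (t := fun n => (a + 1 + n) / (1 + n) * ((b + 1 + n) / (c + 1 + n))) (fun n => ?_) ?_
  · simp only [derivCoeff, coeff_succ hc]
    have h1 : c + n ≠ 0 := by positivity
    have h2 : c + 1 + n ≠ 0 := by positivity
    have h3 : c + (n + 1) ≠ 0 := by positivity
    have h4 : (1 : ℝ) + n ≠ 0 := by positivity
    push_cast
    field_simp
    ring
  · simpa using (tendsto_add_div_add (a + 1) 1).mul (tendsto_add_div_add (b + 1) (c + 1))

/-- Rests on n(c+n) = (a+n)(b+n) - b(c+n) + (c-a)(b+n); summed, it yields the relation for (1-x) v'.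
-/
lemma natCast_mul_coeff (hc : 0 < c) (n : ℕ) : n * coeff a b c n
    = derivCoeff a b c n - (b * coeff a b c n - (c - a) * shiftCoeff a b c n) := by
  have h1 : c + n ≠ 0 := by positivity
  simp only [derivCoeff, shiftCoeff]
  field_simp
  ring

lemma natCast_mul_shiftCoeff (n : ℕ) :
    n * shiftCoeff a b c n = derivCoeff a b c n - a * shiftCoeff a b c n := by
  simp only [derivCoeff, shiftCoeff]
  ring

lemma summableOnUnit_natCast_mul_coeff (ha : 0 < a) (hb : 0 < b) (hc : 0 < c) :
    SummableOnUnit fun n => n * coeff a b c n := by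
  simp only [natCast_mul_coeff hc]
  exact (summableOnUnit_derivCoeff ha hb hc).sub
    (((summableOnUnit_coeff ha hb hc).const_mul b).sub
      ((summableOnUnit_shiftCoeff ha hb hc).const_mul (c - a)))

lemma powerSum_natCast_mul_coeff (ha : 0 < a) (hb : 0 < b) (hc : 0 < c) {x : ℝ}
    (hx : x ∈ Ioo (0 : ℝ) 1) :
    powerSum (fun n => n * coeff a b c n) x = x * powerSum (derivCoeff a b c) x := by
  simp only [powerSum]
  rw [(summableOnUnit_natCast_mul_coeff ha hb hc x hx).tsum_eq_zero_add, ← tsum_mul_left]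
  simp only [Nat.cast_zero, zero_mul, zero_add]
  refine tsum_congr fun n => ?_
  have h1 : c + n ≠ 0 := by positivity
  simp only [derivCoeff, coeff_succ hc]
  push_cast
  field_simp
  ring

/-- `(1 - x) v' = b v - (c - a) h`. -/
lemma one_sub_mul_powerSum_derivCoeff (ha : 0 < a) (hb : 0 < b) (hc : 0 < c) {x : ℝ}
    (hx : x ∈ Ioo (0 : ℝ) 1) :
    (1 - x) * powerSum (derivCoeff a b c) x
      = b * powerSum (coeff a b c) x - (c - a) * powerSum (shiftCoeff a b c) x := by
  have h := powerSum_natCast_mul_coeff ha hb hc hx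
  have h1 := (summableOnUnit_coeff ha hb hc).const_mul b
  have h2 := (summableOnUnit_shiftCoeff ha hb hc).const_mul (c - a)
  simp only [natCast_mul_coeff hc] at h
  rw [powerSum_sub (summableOnUnit_derivCoeff ha hb hc) (h1.sub h2) hx, powerSum_sub h1 h2 hx,
    powerSum_const_mul, powerSum_const_mul] at h
  linarith

lemma hasDerivAt_powerSum_coeff (ha : 0 < a) (hb : 0 < b) (hc : 0 < c) {x : ℝ}
    (hx : x ∈ Ioo (0 : ℝ) 1) :
    HasDerivAt (powerSum (coeff a b c)) (powerSum (derivCoeff a b c) x) x := by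
  have h := hasDerivAt_powerSum (summableOnUnit_coeff ha hb hc) (fun n => (coeff_pos ha hb hc n).le)
    (summableOnUnit_natCast_mul_coeff ha hb hc) hx
  rwa [powerSum_natCast_mul_coeff ha hb hc hx, mul_div_cancel_left₀ _ hx.1.ne'] at h

/-- `x h' = v' - a h`. -/
lemma hasDerivAt_powerSum_shiftCoeff (ha : 0 < a) (hb : 0 < b) (hc : 0 < c) {x : ℝ}
    (hx : x ∈ Ioo (0 : ℝ) 1) :
    HasDerivAt (powerSum (shiftCoeff a b c))
      ((powerSum (derivCoeff a b c) x - a * powerSum (shiftCoeff a b c) x) / x) x := by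
  have h1 := summableOnUnit_derivCoeff ha hb hc
  have h2 := (summableOnUnit_shiftCoeff ha hb hc).const_mul a
  have h := hasDerivAt_powerSum (summableOnUnit_shiftCoeff ha hb hc)
    (fun n => (shiftCoeff_pos ha hb hc n).le)
    (by simp only [natCast_mul_shiftCoeff]; exact h1.sub h2) hx
  simp only [natCast_mul_shiftCoeff] at h
  rwa [powerSum_sub h1 h2 hx, powerSum_const_mul] at h

lemma hasDerivAt_comp_one_sub {f : ℝ → ℝ} {d x : ℝ} (hf : HasDerivAt f d (1 - x)) :
    HasDerivAt (fun t => f (1 - t)) (-d) x := by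
  simpa using hf.comp_const_sub 1 x

lemma legendreM_eq (ha : 0 < a) (hb : 0 < b) (hc : 0 < c) {x : ℝ} (hx : x ∈ Ioo (0 : ℝ) 1) :
    legendreM a b c x = x * (1 - x) *
      (powerSum (coeff a b c) (1 - x) * powerSum (derivCoeff a b c) x
        + powerSum (coeff a b c) x * powerSum (derivCoeff a b c) (1 - x)) := by
  have h1 := (hasDerivAt_powerSum_coeff ha hb hc hx).deriv
  have h2 := (hasDerivAt_comp_one_sub
    (hasDerivAt_powerSum_coeff ha hb hc (one_sub_mem_unit hx))).deriv
  simp only [powerSum_coeff] at h1 h2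
  rw [legendreM, h1, h2, ← powerSum_coeff]
  ring

/-! ### Decomposition of M and derivatives of its parts -/

/-- The symmetric product `v(x) v(1 - x)`. -/
noncomputable def symProd (a b c x : ℝ) : ℝ :=
  powerSum (coeff a b c) x * powerSum (coeff a b c) (1 - x)

/-- The Legendre function `u v₁ + u₁ v - v v₁` with `u = F(a-1,b;c;·)`, written through
`v - u = x h`. -/
noncomputable def legendreL (a b c x : ℝ) : ℝ :=
  symProd a b c x - x * (powerSum (shiftCoeff a b c) x * powerSum (coeff a b c) (1 - x))
    - (1 - x) * (powerSum (shiftCoeff a b c) (1 - x) * powerSum (coeff a b c) x)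

lemma legendreM_eq_legendreL (ha : 0 < a) (hb : 0 < b) (hc : 0 < c) {x : ℝ}
    (hx : x ∈ Ioo (0 : ℝ) 1) :
    legendreM a b c x = (c - a) * legendreL a b c x + (a + b - c) * symProd a b c x := by
  have h1 := one_sub_mul_powerSum_derivCoeff ha hb hc hx
  have h2 := one_sub_mul_powerSum_derivCoeff ha hb hc (one_sub_mem_unit hx)
  rw [sub_sub_cancel] at h2
  rw [legendreM_eq ha hb hc hx, legendreL, symProd]
  linear_combination x * powerSum (coeff a b c) (1 - x) * h1
    + (1 - x) * powerSum (coeff a b c) x * h2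

lemma hasDerivAt_symProd (ha : 0 < a) (hb : 0 < b) (hc : 0 < c) {x : ℝ}
    (hx : x ∈ Ioo (0 : ℝ) 1) :
    HasDerivAt (symProd a b c)
      (powerSum (derivCoeff a b c) x * powerSum (coeff a b c) (1 - x)
        - powerSum (derivCoeff a b c) (1 - x) * powerSum (coeff a b c) x) x := by
  have h := (hasDerivAt_powerSum_coeff ha hb hc hx).mul (hasDerivAt_comp_one_sub
    (hasDerivAt_powerSum_coeff ha hb hc (one_sub_mem_unit hx)))
  convert! h using 1
  ring

lemma hasDerivAt_legendreL (ha : 0 < a) (hb : 0 < b) (hc : 0 < c) {x : ℝ}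
    (hx : x ∈ Ioo (0 : ℝ) 1) :
    HasDerivAt (legendreL a b c) ((a + b - 1) *
      (powerSum (shiftCoeff a b c) x * powerSum (coeff a b c) (1 - x)
        - powerSum (shiftCoeff a b c) (1 - x) * powerSum (coeff a b c) x)) x := by
  have hx1 := one_sub_mem_unit hx
  have hv := hasDerivAt_powerSum_coeff ha hb hc hx
  have hv1 := hasDerivAt_comp_one_sub (hasDerivAt_powerSum_coeff ha hb hc hx1)
  have hh := hasDerivAt_powerSum_shiftCoeff ha hb hc hx
  have hh1 := hasDerivAt_comp_one_sub (hasDerivAt_powerSum_shiftCoeff ha hb hc hx1)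
  have h1 := one_sub_mul_powerSum_derivCoeff ha hb hc hx
  have h2 := one_sub_mul_powerSum_derivCoeff ha hb hc hx1
  rw [sub_sub_cancel] at h2
  have h := ((hasDerivAt_symProd ha hb hc hx).sub ((hasDerivAt_id x).mul (hh.mul hv1))).sub
    (((hasDerivAt_id x).const_sub 1).mul (hh1.mul hv))
  convert! h using 1
  have e0 := hx.1.ne'
  have e1 := hx1.1.ne'
  simp only [id, Pi.mul_apply]
  field_simp
  -- The v' v₁ terms have already cancelled; eliminating the remaining derivatives makes the h h₁
  -- terms cancel too.
  linear_combination powerSum (shiftCoeff a b c) (1 - x) * h1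
    - powerSum (shiftCoeff a b c) x * h2

/-! ### Monotone ratios and convexity of the parts -/

lemma symProd_monotoneOn (ha : 0 < a) (hb : 0 < b) (hc : 0 < c)
    (hD : ∀ x y, 0 < x → x < y → y < 1 →
      powerSum (derivCoeff a b c) x * powerSum (coeff a b c) y
        < powerSum (derivCoeff a b c) y * powerSum (coeff a b c) x) :
    MonotoneOn (symProd a b c) (Ico (1 / 2) 1) := by
  have hmem : ∀ x ∈ Ico (1 / 2 : ℝ) 1, x ∈ Ioo (0 : ℝ) 1 :=
    fun x hx => ⟨by linarith [hx.1], hx.2⟩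
  refine monotoneOn_of_hasDerivWithinAt_nonneg (convex_Ico _ _)
    (fun x hx => (hasDerivAt_symProd ha hb hc (hmem x hx)).continuousAt.continuousWithinAt)
    (fun x hx => (hasDerivAt_symProd ha hb hc
      (hmem x (interior_subset hx))).hasDerivWithinAt) ?_
  intro x hx
  rw [interior_Ico] at hx
  exact (sub_pos.2 (hD (1 - x) x (by linarith [hx.2]) (by linarith [hx.1]) hx.2)).le

/-- After cross-multiplying, the increment is c(a+b+1) - ab + 2cn + n² + n, so the hypothesis is
exactly the case n = 0. -/
lemma strictMono_derivCoeff_ratio (ha : 0 < a) (hb : 0 < b) (hc : 0 < c)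
    (h : a * b / (a + b + 1) < c) :
    StrictMono fun n : ℕ => (a + n) * (b + n) / (c + n) := by
  rw [div_lt_iff₀ (by positivity)] at h
  refine strictMono_nat_of_lt_succ fun n => ?_
  rw [div_lt_div_iff₀ (by positivity) (by positivity)]
  have hn : (0 : ℝ) ≤ n := Nat.cast_nonneg n
  push_cast
  nlinarith [mul_nonneg hn hn, mul_nonneg hn hc.le]

/-- The factor σ absorbs the sign of c-b, so that one argument serves both (ii) and (iii). -/
lemma strictMono_shiftCoeff_ratio {σ : ℝ} (hc : 0 < c) (h : 0 < σ * (c - b)) :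
    StrictMono fun n : ℕ => σ * ((b + n) / (c + n)) := by
  refine strictMono_nat_of_lt_succ fun n => ?_
  have h1 : 0 < c + n := by positivity
  have h2 : 0 < c + (n + 1) := by positivity
  push_cast
  rw [← sub_pos]
  have e : σ * ((b + (n + 1)) / (c + (n + 1))) - σ * ((b + n) / (c + n))
      = σ * (c - b) / ((c + n) * (c + (n + 1))) := by
    field_simp
    ring
  rw [e]
  positivity

lemma derivCoeff_cross (ha : 0 < a) (hb : 0 < b) (hc : 0 < c) (h : a * b / (a + b + 1) < c)
    (x y : ℝ) (hx : 0 < x) (hxy : x < y) (hy : y < 1) :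
    powerSum (derivCoeff a b c) x * powerSum (coeff a b c) y
      < powerSum (derivCoeff a b c) y * powerSum (coeff a b c) x :=
  powerSum_mul_lt_mul (summableOnUnit_coeff ha hb hc) (coeff_pos ha hb hc)
    (strictMono_derivCoeff_ratio ha hb hc h) (summableOnUnit_derivCoeff ha hb hc) hx hxy hy

lemma strictConvexOn_symProd (ha : 0 < a) (hb : 0 < b) (hc : 0 < c)
    (h : a * b / (a + b + 1) < c) : StrictConvexOn ℝ (Ioo 0 1) (symProd a b c) :=
  strictConvexOn_unit_of_hasDerivAt (fun _ hx => hasDerivAt_symProd ha hb hc hx)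
    (strictMonoOn_cross
      (fun _ hx => powerSum_pos (summableOnUnit_coeff ha hb hc) (coeff_pos ha hb hc) hx)
      (symProd_monotoneOn ha hb hc (derivCoeff_cross ha hb hc h)) (derivCoeff_cross ha hb hc h))

lemma strictConvexOn_mul_legendreL (ha : 0 < a) (hb : 0 < b) (hc : 0 < c)
    (h : a * b / (a + b + 1) < c) {k : ℝ} (hk : 0 < k * (a + b - 1) * (c - b)) :
    StrictConvexOn ℝ (Ioo 0 1) (fun x => k * legendreL a b c x) := by
  have hs : ∀ n, k * (a + b - 1) * ((b + n) / (c + n)) * coeff a b c n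
      = k * (a + b - 1) * shiftCoeff a b c n := fun n => mul_assoc _ _ _
  have hcross : ∀ x y, 0 < x → x < y → y < 1 →
      k * (a + b - 1) * powerSum (shiftCoeff a b c) x * powerSum (coeff a b c) y
        < k * (a + b - 1) * powerSum (shiftCoeff a b c) y * powerSum (coeff a b c) x := by
    intro x y hx hxy hy
    have := powerSum_mul_lt_mul (summableOnUnit_coeff ha hb hc) (coeff_pos ha hb hc)
      (strictMono_shiftCoeff_ratio hc hk)
      (by simp only [hs]; exact (summableOnUnit_shiftCoeff ha hb hc).const_mul _) hx hxy hy
    simpa only [hs, powerSum_const_mul] using this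
  refine strictConvexOn_unit_of_hasDerivAt
    (fun x hx => (hasDerivAt_legendreL ha hb hc hx).const_mul k)
    ((strictMonoOn_cross
      (fun _ hx => powerSum_pos (summableOnUnit_coeff ha hb hc) (coeff_pos ha hb hc) hx)
      (symProd_monotoneOn ha hb hc (derivCoeff_cross ha hb hc h)) hcross).congr fun x _ => ?_)
  simp only
  ring

/-! ### Properties of M -/

lemma legendreM_continuousOn (ha : 0 < a) (hb : 0 < b) (hc : 0 < c) :
    ContinuousOn (legendreM a b c) (Ioo 0 1) := by
  refine ContinuousOn.congr (f := fun x => (c - a) * legendreL a b c x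
    + (a + b - c) * symProd a b c x) (fun x hx => ?_)
    (fun x hx => legendreM_eq_legendreL ha hb hc hx)
  exact (((hasDerivAt_legendreL ha hb hc hx).const_mul _).add
    ((hasDerivAt_symProd ha hb hc hx).const_mul _)).continuousAt.continuousWithinAt

lemma legendreM_symm (ha : 0 < a) (hb : 0 < b) (hc : 0 < c) {x : ℝ} (hx : x ∈ Ioo (0 : ℝ) 1) :
    legendreM a b c x = legendreM a b c (1 - x) := by
  rw [legendreM_eq ha hb hc hx, legendreM_eq ha hb hc (one_sub_mem_unit hx), sub_sub_cancel]
  ring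

lemma legendreM_pos (ha : 0 < a) (hb : 0 < b) (hc : 0 < c) {x : ℝ} (hx : x ∈ Ioo (0 : ℝ) 1) :
    0 < legendreM a b c x := by
  have hx1 := one_sub_mem_unit hx
  have hv : ∀ {y}, y ∈ Ioo (0 : ℝ) 1 → 0 < powerSum (coeff a b c) y :=
    powerSum_pos (summableOnUnit_coeff ha hb hc) (coeff_pos ha hb hc)
  have hD : ∀ {y}, y ∈ Ioo (0 : ℝ) 1 → 0 < powerSum (derivCoeff a b c) y :=
    powerSum_pos (summableOnUnit_derivCoeff ha hb hc) (derivCoeff_pos ha hb hc)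
  rw [legendreM_eq ha hb hc hx]
  exact mul_pos (mul_pos hx.1 hx1.1)
    (add_pos (mul_pos (hv hx1) (hD hx)) (mul_pos (hv hx) (hD hx1)))

/-- Covers the boundary cases c = a and c = a+b, where one weight vanishes. -/
lemma strictConvexOn_add_of_weights {f g : ℝ → ℝ} {k l : ℝ}
    (hf : 0 < k → StrictConvexOn ℝ (Ioo 0 1) fun x => k * f x)
    (hg : StrictConvexOn ℝ (Ioo 0 1) g) (hk : 0 ≤ k) (hl : 0 ≤ l) (hkl : 0 < k + l) :
    StrictConvexOn ℝ (Ioo 0 1) fun x => k * f x + l * g x := by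
  have hgl : 0 < l → StrictConvexOn ℝ (Ioo 0 1) fun x => l * g x := fun hl' => by
    refine ⟨hg.1, fun x hx y hy hxy p q hp hq hpq => ?_⟩
    have := mul_lt_mul_of_pos_left (hg.2 hx hy hxy hp hq hpq) hl'
    simp only [smul_eq_mul] at this ⊢
    linarith
  rcases hk.eq_or_lt with rfl | hk'
  · simpa using hgl (by linarith)
  · rcases hl.eq_or_lt with rfl | hl'
    · simpa using hf hk'
    · exact (hf hk').add (hgl hl')

lemma legendreM_strictConvexOn (ha : 0 < a) (hb : 0 < b) (hc : 0 < c)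
    (h : 0 < (a + b - 1) * (c - b)) (h1 : c ≤ a + b) (h2 : a ≤ c)
    (h3 : a * b / (a + b + 1) < c) : StrictConvexOn ℝ (Ioo 0 1) (legendreM a b c) :=
  (strictConvexOn_add_of_weights (k := c - a) (l := a + b - c)
    (fun hk => strictConvexOn_mul_legendreL ha hb hc h3 (by rw [mul_assoc]; positivity))
    (strictConvexOn_symProd ha hb hc h3) (by linarith) (by linarith) (by linarith)).congr
    fun _ hx => (legendreM_eq_legendreL ha hb hc hx).symm

lemma neg_legendreM_strictConvexOn (ha : 0 < a) (hb : 0 < b) (hc : 0 < c)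
    (h : (a + b - 1) * (c - b) < 0) (h1 : a + b ≤ c)
    (h3 : a * b / (a + b + 1) < c) : StrictConvexOn ℝ (Ioo 0 1) (-legendreM a b c) := by
  have hk : 0 < c - a := by linarith
  have hL := strictConvexOn_mul_legendreL ha hb hc h3 (k := -(c - a))
    (by nlinarith)
  refine (strictConvexOn_add_of_weights (k := c - a) (l := c - (a + b))
    (f := fun x => -legendreL a b c x) (fun _ => hL.congr fun x _ => by ring)
    (strictConvexOn_symProd ha hb hc h3) hk.le (by linarith) (by linarith)).congr fun x hx => ?_
  simp only [Pi.neg_apply, legendreM_eq_legendreL ha hb hc hx]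
  ring

/-- By the contiguous relation the n-th coefficient on the right is (ab + (a+b-c)n)/(c+n) times that
of v, hence positive. -/
lemma lt_one_sub_mul_powerSum_derivCoeff (ha : 0 < a) (hb : 0 < b) (hc : 0 < c)
    (h : c ≤ a + b) {x : ℝ} (hx : x ∈ Ioo (0 : ℝ) 1) :
    a * b / c < (1 - x) * powerSum (derivCoeff a b c) x := by
  have h1 := (summableOnUnit_coeff ha hb hc).const_mul b
  have h2 := (summableOnUnit_shiftCoeff ha hb hc).const_mul (c - a)
  have hpos : ∀ n, 0 < b * coeff a b c n - (c - a) * shiftCoeff a b c n := fun n => by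
    have e : b * coeff a b c n - (c - a) * shiftCoeff a b c n
        = (a * b + (a + b - c) * n) / (c + n) * coeff a b c n := by
      have h1 : c + n ≠ 0 := by positivity
      simp only [shiftCoeff]
      field_simp
      ring
    have h0 : 0 ≤ a + b - c := by linarith
    have := coeff_pos ha hb hc n
    rw [e]
    positivity
  have h4 := coeff_zero_lt_powerSum (h1.sub h2) hpos hx
  rw [powerSum_sub h1 h2 hx, powerSum_const_mul, powerSum_const_mul,
    ← one_sub_mul_powerSum_derivCoeff ha hb hc hx] at h4
  refine lt_of_eq_of_lt ?_ h4
  simp only [shiftCoeff, coeff_zero, Nat.cast_zero]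
  field_simp
  ring

/-- M is the average, with weights x and 1-x, of v₁ · (1-x) v'(x) and v · x v'(1-x); each exceeds
ab/c since v > 1. -/
lemma div_lt_legendreM (ha : 0 < a) (hb : 0 < b) (hc : 0 < c) (h : c ≤ a + b) {x : ℝ}
    (hx : x ∈ Ioo (0 : ℝ) 1) : a * b / c < legendreM a b c x := by
  have hx1 := one_sub_mem_unit hx
  have hv : ∀ {y}, y ∈ Ioo (0 : ℝ) 1 → 1 < powerSum (coeff a b c) y := fun hy => by
    simpa only [coeff_zero] using
      coeff_zero_lt_powerSum (summableOnUnit_coeff ha hb hc) (coeff_pos ha hb hc) hy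
  have h1 := lt_one_sub_mul_powerSum_derivCoeff ha hb hc h hx
  have h2 := lt_one_sub_mul_powerSum_derivCoeff ha hb hc h hx1
  rw [sub_sub_cancel] at h2
  have hm : 0 < a * b / c := by positivity
  have h3 := mul_lt_mul_of_pos_left (mul_lt_mul'' (hv hx1) h1 zero_le_one hm.le) hx.1
  have h4 := mul_lt_mul_of_pos_left (mul_lt_mul'' (hv hx) h2 zero_le_one hm.le) hx1.1
  rw [legendreM_eq ha hb hc hx]
  linarith

end Hypergeometric

open Hypergeometric in
theorem mainTheorem3 (a b c : ℝ) (ha : 0 < a) (hb : 0 < b) (hc : 0 < c) :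
    (ContinuousOn (legendreM a b c) (Set.Ioo 0 1) ∧
      ∀ x ∈ Set.Ioo (0 : ℝ) 1,
        legendreM a b c x = legendreM a b c (1 - x) ∧ 0 < legendreM a b c x) ∧
    (0 < (a + b - 1) * (c - b) → c ≤ a + b → a ≤ c → a * b / (a + b + 1) < c →
      StrictConvexOn ℝ (Set.Ioo 0 1) (legendreM a b c) ∧
      StrictAntiOn (legendreM a b c) (Set.Ioc 0 (1 / 2)) ∧
      StrictMonoOn (legendreM a b c) (Set.Ico (1 / 2) 1)) ∧
    ((a + b - 1) * (c - b) < 0 → a + b ≤ c → a * b / (a + b + 1) < c →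
      StrictConcaveOn ℝ (Set.Ioo 0 1) (legendreM a b c) ∧
      StrictMonoOn (legendreM a b c) (Set.Ioc 0 (1 / 2)) ∧
      StrictAntiOn (legendreM a b c) (Set.Ico (1 / 2) 1)) ∧
    (c ≤ a + b → ∀ r ∈ Set.Ioo (0 : ℝ) 1, a * b / c < legendreM a b c r) := by
  have hs : ∀ x ∈ Ioo (0 : ℝ) 1, legendreM a b c x = legendreM a b c (1 - x) :=
    fun _ hx => legendreM_symm ha hb hc hx
  refine ⟨⟨legendreM_continuousOn ha hb hc, fun x hx => ⟨hs x hx, legendreM_pos ha hb hc hx⟩⟩,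
    fun h h1 h2 h3 => ?_, fun h h1 h3 => ?_, fun h r hr => div_lt_legendreM ha hb hc h hr⟩
  · have hM := legendreM_strictConvexOn ha hb hc h h1 h2 h3
    exact ⟨hM, strictConvexOn_symm_strictAntiOn hM hs, strictConvexOn_symm_strictMonoOn hM hs⟩
  · have hM := neg_legendreM_strictConvexOn ha hb hc h h1 h3
    have hs' : ∀ x ∈ Ioo (0 : ℝ) 1, (-legendreM a b c) x = (-legendreM a b c) (1 - x) :=
      fun x hx => congrArg Neg.neg (hs x hx)
    exact ⟨neg_strictConvexOn_iff.1 hM,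
      fun x hx y hy hxy => neg_lt_neg_iff.1 (strictConvexOn_symm_strictAntiOn hM hs' hx hy hxy),
      fun x hx y hy hxy => neg_lt_neg_iff.1 (strictConvexOn_symm_strictMonoOn hM hs' hx hy hxy)⟩
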